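/- Let $G$ be an ample groupoid, i.e. a (not necessarily Hausdorff) locally compact topological groupoid whose unit space $G^{(0)}$ is Hausdorff, whose source and range maps $s,r\colon G\to G^{(0)}$ are local homeomorphisms, and whose topology has a basis of compact open bisections. Write $G_x=s^{-1}(x)$ and $G^x=r^{-1}(x)$ for $x\in G^{(0)}$. Let $$\mathscr{C}_c(G)=\mathrm{span}\{f\colon G\to\mathbb{C} : f|_U\in C_c(U)\text{ and } f|_{G\setminus U}=0\text{ for some open bisection }U\subseteq G\}$$ be Connes' algebra, a $*$-algebra with $f^*(g)=\overline{f(g^{-1})}$ and $(f_1*f_2)(g)=\sum_{h\in G_{s(g)}}f_1(gh^{-1})f_2(h)$, and let $\mathbb{C}G=\mathrm{span}\{\mathbf{1}_U : U\subseteq G\text{ a compact open bisection}\}$ be the complex Steinberg algebra. Let $C^*_r(G)$ be the completion of $\mathscr{C}_c(G)$ in the reduced norm $\|f\|_r=\sup_{x\in G^{(0)}}\|\lambda_x(f)\|$, where $\lambda_x(f)\xi=f*\xi$ on $\ell^2(G_x)$, with its elements viewed as functions on $G$ (as pointwise limits of $\|\cdot\|_r$-Cauchy sequences in $\mathscr{C}_c(G)$).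 Let $$J=\{a\in C^*_r(G) : \{g\in G : a(g)\neq 0\}\text{ has empty interior in }G\}$$ be the singular ideal and $J_{\mathbb{C}}=J\cap\mathbb{C}G$ the algebraic singular ideal. For $f\in\mathscr{C}_c(G)$ put $$\|f\|_I=\max\Big\{\sup_{x\in G^{(0)}}\sum_{g\in G_x}|f(g)|,\ \sup_{x\in G^{(0)}}\sum_{g\in G^x}|f(g)|\Big\}.$$ Then $J_{\mathbb{C}}$ is contained in $J\cap\mathscr{C}_c(G)$ and is dense in it with respect to $\|\cdot\|_I$. Moreover, $J_{\mathbb{C}}$ is dense in $J\cap\mathscr{C}_c(G)$ with respect to any $C^*$-norm on the $*$-algebra $\mathscr{C}_c(G)$. -/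

import Mathlib

open CategoryTheory Topology Filter
open scoped ENNReal

universe v u

noncomputable section

namespace EtaleGpd

variable {X : Type u} [Groupoid.{v} X]

/-! ### The set of morphisms of a groupoid

A groupoid is a category `X` all of whose morphisms are invertible. Its set of morphisms `G` is
`Arrow X`; an arrow `g : u ⟶ v` has source `u = g.left` and range `v = g.right`. -/

/-- The inverse `g⁻¹` of a morphism `g`. -/
def invArrow (g : Arrow X) : Arrow X :=
  Arrow.mk (Groupoid.inv (show g.left ⟶ g.right from g.hom))

/-- The product `g h` of morphisms with `s(g) = r(h)` (first `h`, then `g`). -/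
def mulArrow (g h : Arrow X) (w : g.left = h.right) : Arrow X :=
  Arrow.mk ((show h.left ⟶ h.right from h.hom) ≫ eqToHom w.symm ≫
    (show g.left ⟶ g.right from g.hom))

/-- The source fibre `G_x`. -/
def sourceFibre (x : X) : Set (Arrow X) := {g | g.left = x}

/-- The range fibre `G^x`. -/
def rangeFibre (x : X) : Set (Arrow X) := {g | g.right = x}

variable (X) in
/-- The unit space `G⁽⁰⁾ ⊆ G`, the set of identity morphisms. -/
def unitSpace : Set (Arrow X) := Set.range fun x : X => Arrow.mk (𝟙 x)

/-- The source map `s : G → G⁽⁰⁾`. -/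
def src (g : Arrow X) : unitSpace X := ⟨Arrow.mk (𝟙 g.left), g.left, rfl⟩

/-- The range map `r : G → G⁽⁰⁾`. -/
def rng (g : Arrow X) : unitSpace X := ⟨Arrow.mk (𝟙 g.right), g.right, rfl⟩

/-! ### Topological, étale and ample groupoids -/

section Topology

variable [TopologicalSpace (Arrow X)]

variable (X) in
/-- `G` is a topological groupoid: inverse and product (defined on the set of composable pairs,
with the topology induced by `G × G`) are continuous. -/
structure IsTopologicalGroupoid : Prop where
  continuous_inv : Continuous (invArrow : Arrow X → Arrow X)
  continuous_mul : Continuous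
    fun p : {p : Arrow X × Arrow X // p.1.left = p.2.right} => mulArrow p.1.1 p.1.2 p.2

variable (X) in
/-- `G` is an étale groupoid. It need not be Hausdorff; only its unit space is. -/
structure IsEtaleGroupoid : Prop extends IsTopologicalGroupoid X where
  locallyCompact : LocallyCompactSpace (Arrow X)
  hausdorff_units : T2Space (unitSpace X)
  isLocalHomeomorph_src : IsLocalHomeomorph (src : Arrow X → unitSpace X)
  isLocalHomeomorph_rng : IsLocalHomeomorph (rng : Arrow X → unitSpace X)

/-- Open bisections: open sets on which `s` and `r` are homeomorphisms onto their images. -/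
structure IsOpenBisection (U : Set (Arrow X)) : Prop where
  isOpen : IsOpen U
  isEmbedding_src : IsEmbedding fun g : U => src g.1
  isEmbedding_rng : IsEmbedding fun g : U => rng g.1

variable (X) in
/-- `G` is an ample groupoid: an étale groupoid with a basis of compact open bisections. -/
structure IsAmpleGroupoid : Prop extends IsEtaleGroupoid X where
  isTopologicalBasis :
    TopologicalSpace.IsTopologicalBasis {U : Set (Arrow X) | IsCompact U ∧ IsOpenBisection U}

/-! ### Connes' algebra and the Steinberg algebra -/

variable (X) in
/-- Connes' algebra `𝒞_c(G)`: the span of the functions that vanish outside some open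
bisection `U` and restrict to an element of `C_c(U)`. -/
def connesAlgebra : Submodule ℂ (Arrow X → ℂ) :=
  Submodule.span ℂ {f | ∃ U : Set (Arrow X), IsOpenBisection U ∧
    Continuous (fun g : U => f g) ∧ HasCompactSupport (fun g : U => f g) ∧ ∀ g ∉ U, f g = 0}

variable (X) in
/-- The complex Steinberg algebra `ℂG`: the span of the indicator functions of compact open
bisections. -/
def steinbergAlgebra : Submodule ℂ (Arrow X → ℂ) :=
  Submodule.span ℂ {f | ∃ U : Set (Arrow X), IsCompact U ∧ IsOpenBisection U ∧
    f = U.indicator 1}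

end Topology

/-- The involution `f^*(g) = conj (f (g⁻¹))`. -/
def involution (f : Arrow X → ℂ) : Arrow X → ℂ :=
  fun g => starRingEnd ℂ (f (invArrow g))

/-- Convolution of a function `f` on `G` with a function `ξ` on the source fibre `G_x`:
`(f * ξ)(g) = ∑_{h ∈ G_x} f(g h⁻¹) ξ(h)` for `g ∈ G_x`. For `f` in Connes' algebra only finitely
many summands are nonzero. -/
def fibreConv (f : Arrow X → ℂ) {x : X} (ξ : sourceFibre x → ℂ) : sourceFibre x → ℂ :=
  fun g => ∑ᶠ h : sourceFibre x,
    f (mulArrow g.1 (invArrow h.1) (Eq.trans g.2 h.2.symm)) * ξ h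

/-- Convolution `(f₁ * f₂)(g) = ∑_{h ∈ G_{s(g)}} f₁(g h⁻¹) f₂(h)`. -/
def conv (f₁ f₂ : Arrow X → ℂ) : Arrow X → ℂ :=
  fun g => ∑ᶠ h : sourceFibre g.left,
    f₁ (mulArrow g (invArrow h.1) h.2.symm) * f₂ h.1

/-! ### Norms -/

/-- The `ℓ²`-norm on a source fibre, with value `∞` off `ℓ²(G_x)`. -/
def l2Norm {x : X} (ξ : sourceFibre x → ℂ) : ℝ≥0∞ :=
  (∑' g, ‖ξ g‖ₑ ^ 2) ^ (1 / 2 : ℝ)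

/-- The reduced norm `sup_x ‖λ_x(f)‖`, where `λ_x(f) ξ = f * ξ` on `ℓ²(G_x)`. -/
def reducedNorm (f : Arrow X → ℂ) : ℝ≥0∞ :=
  ⨆ x : X, ⨆ ξ : sourceFibre x → ℂ, ⨆ _ : l2Norm ξ ≤ 1, l2Norm (fibreConv f ξ)

/-- The `I`-norm: the maximum of `sup_x ∑_{g ∈ G_x} |f(g)|` and `sup_x ∑_{g ∈ G^x} |f(g)|`. -/
def normI (f : Arrow X → ℂ) : ℝ≥0∞ :=
  max (⨆ x : X, ∑' g : sourceFibre x, ‖f g‖ₑ) (⨆ x : X, ∑' g : rangeFibre x, ‖f g‖ₑ)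

section Singular

variable [TopologicalSpace (Arrow X)]

/-- `p` is a C*-norm on the *-algebra `𝒞_c(G)` (its values on other functions are irrelevant). -/
structure IsCStarNorm (p : (Arrow X → ℂ) → ℝ) : Prop where
  add_le : ∀ f₁ ∈ connesAlgebra X, ∀ f₂ ∈ connesAlgebra X, p (f₁ + f₂) ≤ p f₁ + p f₂
  smul : ∀ (c : ℂ), ∀ f ∈ connesAlgebra X, p (c • f) = ‖c‖ * p f
  eq_zero : ∀ f ∈ connesAlgebra X, p f = 0 → f = 0
  conv_le : ∀ f₁ ∈ connesAlgebra X, ∀ f₂ ∈ connesAlgebra X, p (conv f₁ f₂) ≤ p f₁ * p f₂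
  involution_conv_self : ∀ f ∈ connesAlgebra X, p (conv (involution f) f) = p f ^ 2

variable (X) in
/-- The reduced C*-algebra `C*_r(G)`, the completion of `𝒞_c(G)` in the reduced norm, with its
elements viewed as functions on `G`: the element represented by a Cauchy sequence in `𝒞_c(G)` is
viewed as the pointwise limit of that sequence. -/
def reducedCStarAlgebra : Set (Arrow X → ℂ) :=
  {a | ∃ f : ℕ → Arrow X → ℂ, (∀ n, f n ∈ connesAlgebra X) ∧
    (∀ ε : ℝ≥0∞, 0 < ε → ∃ N, ∀ m ≥ N, ∀ n ≥ N, reducedNorm (f m - f n) < ε) ∧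
    ∀ g, Tendsto (fun n => f n g) atTop (𝓝 (a g))}

variable (X) in
/-- The singular ideal `J` of `C*_r(G)`: the elements `a` such that `{g | a(g) ≠ 0}` has empty
interior in `G`. -/
def singularIdeal : Set (Arrow X → ℂ) :=
  {a | a ∈ reducedCStarAlgebra X ∧ interior {g | a g ≠ 0} = ∅}

variable (X) in
/-- The algebraic singular ideal `J_ℂ = J ∩ ℂG`. -/
def algebraicSingularIdeal : Set (Arrow X → ℂ) :=
  singularIdeal X ∩ steinbergAlgebra X

end Singular

end EtaleGpd

end

/-!
# Density of the algebraic singular ideal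

Let `f` be a singular element of Connes' algebra. As `G` is ample, `f = ∑ i, F i` with `F i`
continuous on a compact open bisection `K i` and zero off it
(`IsAmpleGroupoid.exists_sum_isBisectionFunction`). Transport `F i` along the source map to a
continuous function `φ i` on the unit space (`toUnits`). For a set `I` of indices, let `C I` be the
closure of the image in the unit space of the interior of the stratum of arrows lying in `K i`
precisely for `i ∈ I`. On that interior `f` is continuous, so singularity of `f` forces
`∑ i ∈ I, φ i = 0` on `C I` (`sum_toUnits_eq_zero`). Conversely, these finitely many linear relations
imply singularity, because the interiors of the strata are jointly dense
(`exists_open_subset_or_disjoint`).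

The set of relations imposed at a point is upper semicontinuous: as the `C I` are closed, every `y`
near `x` has `{I | y ∈ C I} ⊆ {I | x ∈ C I}`. Hence the values `φ i x` are admissible at all points
`y` near `x`. Since the unit space has a basis of clopen sets, there is a locally constant map `π`
sending each point of the relevant compact set to a nearby representative
(`exists_isLocallyConstant_mem`), and replacing each `φ i` by `φ i ∘ π` gives an element of the
Steinberg algebra that is again singular (`IsAmpleGroupoid.exists_approx`). The error is a sum of
functions on bisections that are uniformly small, and whose number depends only on `f`.

It remains to bound norms of a function `h` on a bisection by its supremum. For the `I`-norm this
holds since a bisection meets every fibre at most once. For a C*-norm `p`, the element `h^* * h` is a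
continuous function on the unit space, so that it suffices to see `p b ≤ 1` for continuous `b` there
with values in `[-1, 1]`. Such a `b` is the real part of the unitary `b + i √(1 - b²)`, which yields
the bound without completeness of `p` (`IsCStarNorm.onUnits_le_one`).
-/

namespace EtaleGpd

variable {X : Type u} [Groupoid.{v} X]

/-! ### Arrows -/

theorem src_eq_src_iff {g h : Arrow X} : src g = src h ↔ g.left = h.left := by
  constructor
  · intro e
    exact congrArg (fun a : unitSpace X => a.1.left) e
  · intro e
    exact Subtype.ext (congrArg (fun x : X => Arrow.mk (𝟙 x)) e)

theorem rng_eq_rng_iff {g h : Arrow X} : rng g = rng h ↔ g.right = h.right := by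
  constructor
  · intro e
    exact congrArg (fun a : unitSpace X => a.1.right) e
  · intro e
    exact Subtype.ext (congrArg (fun x : X => Arrow.mk (𝟙 x)) e)

theorem src_unit (x : unitSpace X) : src x.1 = x := by
  obtain ⟨_, x, rfl⟩ := x
  rfl

theorem rng_unit (x : unitSpace X) : rng x.1 = x := by
  obtain ⟨_, x, rfl⟩ := x
  rfl

theorem invArrow_invArrow (g : Arrow X) : invArrow (invArrow g) = g := by
  obtain ⟨x, y, g⟩ := g
  change Arrow.mk (Groupoid.inv (Groupoid.inv (X := x) (Y := y) g)) = Arrow.mk (X := x) (Y := y) g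
  simp

theorem invArrow_of_mem_unitSpace {g : Arrow X} (hg : g ∈ unitSpace X) : invArrow g = g := by
  obtain ⟨x, rfl⟩ := hg
  change Arrow.mk (Groupoid.inv (𝟙 x)) = Arrow.mk (𝟙 x)
  simp

theorem invArrow_mem_unitSpace_iff {g : Arrow X} : invArrow g ∈ unitSpace X ↔ g ∈ unitSpace X := by
  refine ⟨fun h => ?_, fun h => (invArrow_of_mem_unitSpace h).symm ▸ h⟩
  rw [← invArrow_invArrow g, invArrow_of_mem_unitSpace h]
  exact h

theorem mulArrow_invArrow_of_mem_unitSpace (g : Arrow X) {h : Arrow X} (hh : h ∈ unitSpace X)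
    (w : g.left = (invArrow h).right) : mulArrow g (invArrow h) w = g := by
  obtain ⟨x, rfl⟩ := hh
  obtain ⟨y, z, g⟩ := g
  obtain rfl : y = x := w
  change Arrow.mk (Groupoid.inv (𝟙 y) ≫ 𝟙 _ ≫ g) = Arrow.mk (X := y) (Y := z) g
  simp

/-- The equation `h g⁻¹ = h` forces `g` to be a unit, and conversely. -/
theorem invArrow_mulArrow_invArrow_eq_iff (g h : Arrow X) (w : g.left = (invArrow h).right) :
    invArrow (mulArrow g (invArrow h) w) = h ↔ g ∈ unitSpace X := by
  obtain ⟨x, y, g⟩ := g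
  obtain ⟨x', z, h⟩ := h
  obtain rfl : x = x' := w
  change Arrow.mk (Groupoid.inv (Groupoid.inv (X := x) (Y := z) h ≫ 𝟙 _ ≫ (g : x ⟶ y))) =
    Arrow.mk (X := x) (Y := z) h ↔ Arrow.mk (X := x) (Y := y) g ∈ unitSpace X
  constructor
  · intro e
    obtain rfl : y = x := congrArg (fun a : Arrow X => a.left) e
    have e' := Arrow.mk_injective _ _ e
    simp only [Groupoid.inv_eq_inv, Category.id_comp, IsIso.inv_comp, IsIso.inv_inv] at e'
    have : inv (C := X) g = 𝟙 y := by
      exact (cancel_mono (C := X) h).1 (by simpa using e')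
    refine ⟨y, ?_⟩
    have hg : (g : y ⟶ y) = 𝟙 y := by
      simpa using (congrArg (fun k : y ⟶ y => g ≫ k) this).symm
    rw [hg]
  · rintro ⟨a, e⟩
    obtain rfl : a = x := congrArg (fun a : Arrow X => a.left) e
    obtain rfl : a = y := congrArg (fun a : Arrow X => a.right) e
    have e' : 𝟙 a = g := Arrow.mk_injective _ _ e
    subst e'
    simp

section Topology

variable [TopologicalSpace (Arrow X)]

/-! ### Bisections and the unit space -/

theorem IsOpenBisection.injOn_src {K : Set (Arrow X)} (hK : IsOpenBisection K) :
    Set.InjOn src K := Set.injOn_iff_injective.2 hK.isEmbedding_src.injective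

theorem IsOpenBisection.injOn_rng {K : Set (Arrow X)} (hK : IsOpenBisection K) :
    Set.InjOn rng K := Set.injOn_iff_injective.2 hK.isEmbedding_rng.injective

theorem IsOpenBisection.mono {K U : Set (Arrow X)} (hU : IsOpenBisection U) (hK : IsOpen K)
    (hKU : K ⊆ U) : IsOpenBisection K where
  isOpen := hK
  isEmbedding_src := hU.isEmbedding_src.comp (.inclusion hKU)
  isEmbedding_rng := hU.isEmbedding_rng.comp (.inclusion hKU)

theorem IsOpenBisection.isOpenEmbedding_src (hG : IsEtaleGroupoid X) {K : Set (Arrow X)}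
    (hK : IsOpenBisection K) : IsOpenEmbedding fun g : K => src g.1 where
  toIsEmbedding := hK.isEmbedding_src
  isOpen_range := by
    rw [← Set.image_eq_range]
    exact hG.isLocalHomeomorph_src.isOpenMap _ hK.isOpen

/-- The unit space of an étale groupoid is open: its inclusion is a continuous section of the local
homeomorphism `src`. -/
theorem IsEtaleGroupoid.isOpenEmbedding_unit (hG : IsEtaleGroupoid X) :
    IsOpenEmbedding (Subtype.val : unitSpace X → Arrow X) := by
  refine IsLocalHomeomorph.isOpenEmbedding_of_injective ?_ Subtype.val_injective
  refine IsLocalHomeomorph.of_comp (g := src) ?_ hG.isLocalHomeomorph_src continuous_subtype_val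
  have : (src ∘ Subtype.val : unitSpace X → unitSpace X) = id := funext src_unit
  rw [this]
  exact (Homeomorph.refl _).isLocalHomeomorph

theorem IsEtaleGroupoid.isOpenBisection_image_unit (hG : IsEtaleGroupoid X)
    {V : Set (unitSpace X)} (hV : IsOpen V) :
    IsOpenBisection (Subtype.val '' V : Set (Arrow X)) := by
  have hval := hG.isOpenEmbedding_unit
  have key : ∀ f : Arrow X → unitSpace X, Continuous f → (∀ x : unitSpace X, f x.1 = x) →
      IsEmbedding fun g : (Subtype.val '' V : Set (Arrow X)) => f g.1 := by
    intro f hf hfx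
    refine IsEmbedding.of_comp (g := (Subtype.val : unitSpace X → Arrow X))
      (hf.comp continuous_subtype_val) continuous_subtype_val ?_
    convert IsEmbedding.subtypeVal (p := (· ∈ (Subtype.val '' V : Set (Arrow X)))) using 1
    funext g
    obtain ⟨_, x, hx, rfl⟩ := g
    exact congrArg Subtype.val (hfx x)
  exact ⟨hval.isOpenMap _ hV, key _ hG.isLocalHomeomorph_src.continuous src_unit,
    key _ hG.isLocalHomeomorph_rng.continuous rng_unit⟩

theorem IsAmpleGroupoid.exists_isClopen_subset (hG : IsAmpleGroupoid X)
    {x : unitSpace X} {O : Set (unitSpace X)} (hO : IsOpen O) (hx : x ∈ O) :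
    ∃ N ⊆ O, x ∈ N ∧ IsClopen N := by
  have := hG.hausdorff_units
  have hval := hG.isOpenEmbedding_unit
  obtain ⟨K, ⟨hKc, hKb⟩, hxK, hKO⟩ := hG.isTopologicalBasis.exists_subset_of_mem_open
    (Set.mem_image_of_mem Subtype.val hx) (hval.isOpenMap _ hO)
  refine ⟨Subtype.val ⁻¹' K, ?_, hxK, ?_, hKb.isOpen.preimage continuous_subtype_val⟩
  · intro y hy
    exact (Subtype.val_injective.mem_set_image).1 (hKO hy)
  · refine IsCompact.isClosed (hval.isInducing.isCompact_preimage' hKc ?_)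
    exact hKO.trans (Set.image_subset_range _ _)

theorem IsOpenBisection.isClopen_image_src (hG : IsEtaleGroupoid X) {K : Set (Arrow X)}
    (hK : IsOpenBisection K) (hKc : IsCompact K) : IsClopen (src '' K) :=
  have := hG.hausdorff_units
  ⟨(hKc.image hG.isLocalHomeomorph_src.continuous).isClosed,
    hG.isLocalHomeomorph_src.isOpenMap _ hK.isOpen⟩

/-- Every compact subset of an open bisection is contained in a compact open bisection
contained in it. -/
theorem IsAmpleGroupoid.exists_isCompact_isOpenBisection (hG : IsAmpleGroupoid X)
    {T U : Set (Arrow X)} (hT : IsCompact T) (hU : IsOpenBisection U) (hTU : T ⊆ U) :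
    ∃ K, IsCompact K ∧ IsOpenBisection K ∧ T ⊆ K ∧ K ⊆ U := by
  suffices h : ∃ K, IsCompact K ∧ IsOpen K ∧ T ⊆ K ∧ K ⊆ U by
    obtain ⟨K, hKc, hKo, hTK, hKU⟩ := h
    exact ⟨K, hKc, hU.mono hKo hKU, hTK, hKU⟩
  choose! N hN using fun (g : Arrow X) (hg : g ∈ T) =>
    hG.isTopologicalBasis.exists_subset_of_mem_open (hTU hg) hU.isOpen
  obtain ⟨t, ht, htT⟩ := hT.elim_nhds_subcover N
    fun g hg => (hN g hg).1.2.isOpen.mem_nhds (hN g hg).2.1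
  exact ⟨⋃ g ∈ t, N g, t.isCompact_biUnion fun g hg => (hN g (ht g hg)).1.1,
    isOpen_biUnion fun g hg => (hN g (ht g hg)).1.2.isOpen, htT,
    Set.iUnion₂_subset fun g hg => (hN g (ht g hg)).2.2⟩

/-! ### Functions on a compact open bisection -/

/-- `f` is supported on the compact open bisection `K` and continuous on it. Extended by zero, such
functions need not be continuous on `G`, as `K` need not be closed. -/
structure IsBisectionFunction (K : Set (Arrow X)) (f : Arrow X → ℂ) : Prop where
  isCompact : IsCompact K
  isOpenBisection : IsOpenBisection K
  continuousOn : ContinuousOn f K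
  eq_zero : ∀ g ∉ K, f g = 0

theorem IsBisectionFunction.mem_connesAlgebra {K : Set (Arrow X)} {f : Arrow X → ℂ}
    (hf : IsBisectionFunction K f) : f ∈ connesAlgebra X := by
  have := isCompact_iff_compactSpace.1 hf.isCompact
  exact Submodule.subset_span ⟨K, hf.isOpenBisection, continuousOn_iff_continuous_domRestrict.1
    hf.continuousOn, HasCompactSupport.of_compactSpace _, hf.eq_zero⟩

theorem IsBisectionFunction.smul {K : Set (Arrow X)} {f : Arrow X → ℂ}
    (hf : IsBisectionFunction K f) (c : ℂ) : IsBisectionFunction K (c • f) :=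
  ⟨hf.1, hf.2, hf.3.const_smul c, fun g hg => by simp [hf.4 g hg]⟩

theorem steinbergAlgebra_le_connesAlgebra : steinbergAlgebra X ≤ connesAlgebra X := by
  refine Submodule.span_le.2 ?_
  rintro _ ⟨U, hUc, hU, rfl⟩
  refine IsBisectionFunction.mem_connesAlgebra (K := U) ⟨hUc, hU, ?_, fun g hg => ?_⟩
  · exact (continuousOn_const (c := (1 : ℂ))).congr fun g hg => Set.indicator_of_mem hg _
  · exact Set.indicator_of_notMem hg _

/-- In an ample groupoid, elements of Connes' algebra are finite sums of functions supported on
compact open bisections. -/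
theorem IsAmpleGroupoid.exists_sum_isBisectionFunction (hG : IsAmpleGroupoid X)
    {f : Arrow X → ℂ} (hf : f ∈ connesAlgebra X) :
    ∃ (n : ℕ) (K : Fin n → Set (Arrow X)) (F : Fin n → Arrow X → ℂ),
      (∀ i, IsBisectionFunction (K i) (F i)) ∧ f = ∑ i, F i := by
  obtain ⟨n, c, F, rfl⟩ := Submodule.mem_span_set'.1 hf
  have key : ∀ i, ∃ K, IsBisectionFunction K (F i).1 := by
    intro i
    obtain ⟨U, hU, hcont, hsupp, hzero⟩ := (F i).2
    obtain ⟨K, hKc, hK, hTK, hKU⟩ := hG.exists_isCompact_isOpenBisection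
      (T := Subtype.val '' tsupport fun g : U => (F i).1 g)
      (hsupp.isCompact.image continuous_subtype_val) hU
      (by rintro _ ⟨g, -, rfl⟩; exact g.2)
    refine ⟨K, hKc, hK, (continuousOn_iff_continuous_domRestrict.2 hcont).mono hKU, fun g hg => ?_⟩
    by_cases hgU : g ∈ U
    · by_contra hne
      exact hg (hTK ⟨⟨g, hgU⟩, subset_tsupport _ hne, rfl⟩)
    · exact hzero g hgU
  choose K hK using key
  exact ⟨n, K, fun i => c i • (F i).1, fun i => (hK i).smul _, rfl⟩

/-- The function `f|_K` on a bisection `K`, transported to the unit space along the source map and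
extended by zero. -/
noncomputable def toUnits (K : Set (Arrow X)) (f : Arrow X → ℂ) : unitSpace X → ℂ :=
  Function.extend (fun g : K => src g.1) (fun g : K => f g.1) 0

theorem toUnits_src {K : Set (Arrow X)} (hK : IsOpenBisection K) (f : Arrow X → ℂ) {g : Arrow X}
    (hg : g ∈ K) : toUnits K f (src g) = f g :=
  hK.isEmbedding_src.injective.extend_apply (fun g : K => f g.1) 0 ⟨g, hg⟩

omit [TopologicalSpace (Arrow X)] in
theorem toUnits_of_notMem {K : Set (Arrow X)} (f : Arrow X → ℂ) {x : unitSpace X}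
    (hx : x ∉ src '' K) : toUnits K f x = 0 :=
  Function.extend_apply' _ _ _ fun ⟨g, hg⟩ => hx ⟨g.1, g.2, hg⟩

theorem IsBisectionFunction.continuous_toUnits (hG : IsEtaleGroupoid X) {K : Set (Arrow X)}
    {f : Arrow X → ℂ} (hf : IsBisectionFunction K f) : Continuous (toUnits K f) := by
  refine continuous_iff_continuousAt.2 fun x => ?_
  by_cases hx : x ∈ src '' K
  · obtain ⟨g, hg, rfl⟩ := hx
    have hemb := hf.isOpenBisection.isOpenEmbedding_src hG
    refine (hemb.continuousAt_iff (x := ⟨g, hg⟩)).1 ?_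
    have : toUnits K f ∘ (fun g : K => src g.1) = K.domRestrict f :=
      funext fun g => toUnits_src hf.isOpenBisection f g.2
    rw [this]
    exact (continuousOn_iff_continuous_domRestrict.1 hf.continuousOn).continuousAt
  · have hcl := (hf.isOpenBisection.isClopen_image_src hG hf.isCompact).compl
    refine continuousAt_const.congr (f := fun _ => (0 : ℂ)) ?_
    filter_upwards [hcl.isOpen.mem_nhds hx] with y hy
    exact (toUnits_of_notMem f hy).symm

/-- Multiplying the indicator of a compact open bisection by a locally constant function gives an
element of the Steinberg algebra. -/
theorem indicator_mem_steinbergAlgebra {K : Set (Arrow X)} (hKc : IsCompact K)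
    (hK : IsOpenBisection K) {c : Arrow X → ℂ} (hc : IsLocallyConstant c) :
    K.indicator c ∈ steinbergAlgebra X := by
  have := isCompact_iff_compactSpace.1 hKc
  have hfin : (Set.range fun g : K => c g.1).Finite :=
    (hc.comp_continuous continuous_subtype_val).range_finite
  have : K.indicator c = ∑ z ∈ hfin.toFinset, z • (K ∩ c ⁻¹' {z}).indicator (1 : Arrow X → ℂ) := by
    funext g
    rw [Finset.sum_apply]
    by_cases hg : g ∈ K
    · rw [Set.indicator_of_mem hg, Finset.sum_eq_single (c g)]
      · simp [hg]
      · intro z _ hz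
        simp [hz.symm]
      · intro h
        exact absurd (hfin.mem_toFinset.2 ⟨⟨g, hg⟩, rfl⟩) h
    · rw [Set.indicator_of_notMem hg]
      exact (Finset.sum_eq_zero fun z _ => by simp [hg]).symm
  rw [this]
  refine Submodule.sum_mem _ fun z _ => Submodule.smul_mem _ _ (Submodule.subset_span ?_)
  exact ⟨_, hKc.inter_right (hc.isClosed_fiber z),
    hK.mono (hK.isOpen.inter (hc.isOpen_fiber z)) Set.inter_subset_left, rfl⟩

/-! ### Approximation of singular elements -/

/-- If every point `x` has a clopen neighbourhood `N x`, then on a compact set the points can be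
replaced by finitely many representatives, in a locally constant way and so that each point lies in
the neighbourhood of its representative. -/
theorem exists_isLocallyConstant_mem {S : Type*} [TopologicalSpace S] {N : S → Set S}
    (hN : ∀ x, IsClopen (N x)) (hmem : ∀ x, x ∈ N x) {C : Set S} (hC : IsCompact C) :
    ∃ π : S → S, IsLocallyConstant π ∧ ∀ y ∈ C, y ∈ N (π y) := by
  classical
  rcases isEmpty_or_nonempty S with hS | ⟨⟨x₀⟩⟩
  · exact ⟨id, IsLocallyConstant.of_constant _ fun x => isEmptyElim x, fun y => isEmptyElim y⟩
  obtain ⟨t, -, ht⟩ := hC.elim_nhds_subcover N fun x _ => (hN x).isOpen.mem_nhds (hmem x)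
  suffices h : ∃ π : S → S, IsLocallyConstant π ∧ ∀ y ∈ ⋃ x ∈ t, N x, y ∈ N (π y) by
    obtain ⟨π, h1, h2⟩ := h
    exact ⟨π, h1, fun y hy => h2 y (ht hy)⟩
  clear ht
  induction t using Finset.induction_on with
  | empty => exact ⟨_, IsLocallyConstant.const x₀, by simp⟩
  | insert a t _ ih =>
    obtain ⟨π, hπ, hmemπ⟩ := ih
    refine ⟨fun y => if y ∈ N a then a else π y, ?_, fun y hy => ?_⟩
    · refine (IsLocallyConstant.iff_eventually_eq _).2 fun x => ?_
      by_cases hx : x ∈ N a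
      · filter_upwards [(hN a).isOpen.mem_nhds hx] with y hy
        simp [hx, hy]
      · filter_upwards [(hN a).compl.isOpen.mem_nhds hx, hπ.eventually_eq x] with y hy hyx
        simp only [if_neg hx, if_neg hy, hyx]
    · by_cases hya : y ∈ N a
      · simp [hya]
      · simp only [if_neg hya]
        exact hmemπ y (by simpa [hya] using hy)

/-- Relative to finitely many open sets, every nonempty open set contains a nonempty open set whose
points all lie in the same ones. -/
theorem exists_open_subset_or_disjoint {S ι : Type*} [TopologicalSpace S] (t : Finset ι)
    {K : ι → Set S} (hK : ∀ i, IsOpen (K i)) {O : Set S} (hO : IsOpen O) (hne : O.Nonempty) :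
    ∃ O' ⊆ O, IsOpen O' ∧ O'.Nonempty ∧ ∀ i ∈ t, O' ⊆ K i ∨ Disjoint O' (K i) := by
  classical
  induction t using Finset.induction_on with
  | empty => exact ⟨O, subset_rfl, hO, hne, by simp⟩
  | insert a t _ ih =>
    obtain ⟨O', hsub, hO', hne', h⟩ := ih
    by_cases ha : Disjoint O' (K a)
    · exact ⟨O', hsub, hO', hne', by simpa [ha] using h⟩
    · refine ⟨O' ∩ K a, Set.inter_subset_left.trans hsub, hO'.inter (hK a),
        Set.not_disjoint_iff_nonempty_inter.1 ha, fun i hi => ?_⟩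
      rcases Finset.mem_insert.1 hi with rfl | hi
      · exact Or.inl Set.inter_subset_right
      · exact (h i hi).imp Set.inter_subset_left.trans (Disjoint.mono_left Set.inter_subset_left)

/-- A finite sum of functions on bisections `K i` that vanishes on a dense set also vanishes, once
transported to the unit space, on the closure of the image of the interior of each stratum of the
family `K`, a stratum being the set of arrows that lie in `K i` precisely for `i` in a given set. -/
theorem sum_toUnits_eq_zero (hG : IsEtaleGroupoid X) {n : ℕ} {K : Fin n → Set (Arrow X)}
    {F : Fin n → Arrow X → ℂ} (hF : ∀ i, IsBisectionFunction (K i) (F i))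
    (hsing : interior {g | (∑ i, F i) g ≠ 0} = ∅) (I : Finset (Fin n)) {x : unitSpace X}
    (hx : x ∈ closure (src '' interior {g | ∀ i, g ∈ K i ↔ i ∈ I})) :
    ∑ i ∈ I, toUnits (K i) (F i) x = 0 := by
  have hclosed : IsClosed {x | ∑ i ∈ I, toUnits (K i) (F i) x = 0} :=
    isClosed_eq (continuous_finsetSum _ fun i _ => (hF i).continuous_toUnits hG) continuous_const
  refine closure_minimal ?_ hclosed hx
  rintro _ ⟨g, hg, rfl⟩
  set Q := interior {g | ∀ i, g ∈ K i ↔ i ∈ I} with hQ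
  have hQK : ∀ g ∈ Q, ∀ i, g ∈ K i ↔ i ∈ I := fun g hg => interior_subset hg
  have hsum : ∀ g ∈ Q, ∑ i ∈ I, toUnits (K i) (F i) (src g) = (∑ i, F i) g := by
    intro g hg
    rw [Finset.sum_apply, ← Finset.sum_subset (Finset.subset_univ I)
      fun i _ hi => (hF i).eq_zero g (mt (hQK g hg i).1 hi)]
    exact Finset.sum_congr rfl fun i hi =>
      toUnits_src (hF i).isOpenBisection _ ((hQK g hg i).2 hi)
  by_contra hne
  have hopen : IsOpen (Q ∩ {g | ∑ i ∈ I, toUnits (K i) (F i) (src g) ≠ 0}) :=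
    isOpen_interior.inter (isOpen_ne_fun (continuous_finsetSum _ fun i _ =>
      ((hF i).continuous_toUnits hG).comp hG.isLocalHomeomorph_src.continuous) continuous_const)
  have hsub : Q ∩ {g | ∑ i ∈ I, toUnits (K i) (F i) (src g) ≠ 0} ⊆ {g | (∑ i, F i) g ≠ 0} :=
    fun g hg => by
      have := hg.2
      rw [Set.mem_ofPred_eq, hsum g hg.1] at this
      exact this
  have := interior_maximal hsub hopen ⟨hg, hne⟩
  rw [hsing] at this
  exact this

/-- Near each point the linear relations imposed by singularity are among those imposed at that
point, so freezing the coefficient functions at finitely many points of the unit space preserves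
singularity. The number of summands of the error does not depend on `δ`. -/
theorem IsAmpleGroupoid.exists_approx (hG : IsAmpleGroupoid X) {f : Arrow X → ℂ}
    (hf : f ∈ connesAlgebra X) (hsing : interior {g | f g ≠ 0} = ∅) :
    ∃ n : ℕ, ∀ δ : ℝ, 0 < δ → ∃ f' ∈ steinbergAlgebra X, interior {g | f' g ≠ 0} = ∅ ∧
      ∃ h : Fin n → Arrow X → ℂ, f - f' = ∑ i, h i ∧
        ∀ i, (∃ K, IsBisectionFunction K (h i)) ∧ ∀ g, ‖h i g‖ ≤ δ := by
  classical
  obtain ⟨n, K, F, hF, rfl⟩ := hG.exists_sum_isBisectionFunction hf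
  have hE := hG.toIsEtaleGroupoid
  have hs : Continuous (src : Arrow X → unitSpace X) := hE.isLocalHomeomorph_src.continuous
  refine ⟨n, fun δ hδ => ?_⟩
  set φ : Fin n → unitSpace X → ℂ := fun i => toUnits (K i) (F i) with hφ
  have hφc : ∀ i, Continuous (φ i) := fun i => (hF i).continuous_toUnits hE
  let C : Finset (Fin n) → Set (unitSpace X) := fun I =>
    closure (src '' interior {g | ∀ i, g ∈ K i ↔ i ∈ I})
  -- on `N x` the `φ i` vary by less than `δ`, and every relation imposed there is imposed at `x`
  have hN : ∀ x : unitSpace X, ∃ N : Set (unitSpace X), IsClopen N ∧ x ∈ N ∧ ∀ y ∈ N,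
      (∀ i, ‖φ i y - φ i x‖ < δ) ∧ ∀ I, y ∈ C I → x ∈ C I := by
    intro x
    have hev : ∀ᶠ y in 𝓝 x, (∀ i, ‖φ i y - φ i x‖ < δ) ∧ ∀ I, y ∈ C I → x ∈ C I := by
      refine (eventually_all.2 fun i => ?_).and (eventually_all.2 fun I => ?_)
      · have h := (hφc i).continuousAt.eventually (Metric.ball_mem_nhds (φ i x) hδ)
        filter_upwards [h] with y hy
        rwa [← dist_eq_norm]
      · by_cases hxI : x ∈ C I
        · exact Eventually.of_forall fun y _ => hxI
        · filter_upwards [isClosed_closure.isOpen_compl.mem_nhds hxI] with y hy hyI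
          exact absurd hyI hy
    obtain ⟨O, hO, hOo, hxO⟩ := eventually_nhds_iff.1 hev
    obtain ⟨N, hNO, hxN, hN⟩ := hG.exists_isClopen_subset hOo hxO
    exact ⟨N, hN, hxN, fun y hy => hO y (hNO hy)⟩
  choose N hNclopen hNmem hNprop using hN
  obtain ⟨π, hπ, hπN⟩ := exists_isLocallyConstant_mem hNclopen hNmem
    (isCompact_iUnion fun i => (hF i).isCompact.image hs)
  have hπK : ∀ i, ∀ g ∈ K i, src g ∈ N (π (src g)) := fun i g hg =>
    hπN _ (Set.mem_iUnion.2 ⟨i, g, hg, rfl⟩)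
  -- the frozen coefficients
  let c : Fin n → Arrow X → ℂ := fun i g => φ i (π (src g))
  have hc : ∀ i, IsLocallyConstant (c i) := fun i => (hπ.comp (φ i)).comp_continuous hs
  refine ⟨∑ i, (K i).indicator (c i), Submodule.sum_mem _ fun i _ =>
    indicator_mem_steinbergAlgebra (hF i).isCompact (hF i).isOpenBisection (hc i), ?_,
    fun i => F i - (K i).indicator (c i), (Finset.sum_sub_distrib _ _).symm,
    fun i => ⟨⟨K i, (hF i).isCompact, (hF i).isOpenBisection, ?_, fun g hg => ?_⟩, fun g => ?_⟩⟩
  · by_contra hne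
    obtain ⟨O, hOsub, hO, ⟨g, hg⟩, hOK⟩ := exists_open_subset_or_disjoint Finset.univ
      (fun i => (hF i).isOpenBisection.isOpen) isOpen_interior (Set.nonempty_iff_ne_empty.2 hne)
    refine interior_subset (hOsub hg) ?_
    let I : Finset (Fin n) := Finset.univ.filter fun i => O ⊆ K i
    have hI : ∀ g ∈ O, ∀ i, g ∈ K i ↔ i ∈ I := by
      intro g hg i
      simp only [I, Finset.mem_filter, Finset.mem_univ, true_and]
      refine ⟨fun hgi => (hOK i (Finset.mem_univ i)).resolve_right fun hd => ?_, fun h => h hg⟩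
      exact Set.disjoint_left.1 hd hg hgi
    -- `O` lies in the interior of the stratum of `I`, so the relation of `I` holds at `π (src g)`
    have hgC : src g ∈ C I :=
      subset_closure ⟨g, interior_maximal hI hO hg, rfl⟩
    rw [Finset.sum_apply, ← Finset.sum_subset (Finset.subset_univ I)
      fun i _ hi => Set.indicator_of_notMem (mt (hI g hg i).1 hi) _]
    rcases I.eq_empty_or_nonempty with h0 | ⟨i₀, hi₀⟩
    · simp [h0]
    have hgN := hπK i₀ g ((hI g hg i₀).2 hi₀)
    rw [Finset.sum_congr rfl fun i hi => Set.indicator_of_mem ((hI g hg i).2 hi) (c i)]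
    exact sum_toUnits_eq_zero hE hF hsing I ((hNprop _ _ hgN).2 I hgC)
  · refine ((hF i).continuousOn.sub (hc i).continuous.continuousOn).congr fun g hg => ?_
    simp [hg]
  · simp [hg, (hF i).eq_zero g hg]
  · by_cases hg : g ∈ K i
    · have h := ((hNprop _ _ (hπK i g hg)).1 i).le
      rw [hφ] at h
      simp only [toUnits_src (hF i).isOpenBisection _ hg] at h
      simpa [hg, c, hφ] using h
    · simpa [hg, (hF i).eq_zero g hg] using hδ.le

/-! ### The `I`-norm -/

omit [TopologicalSpace (Arrow X)] in
theorem normI_zero : normI (0 : Arrow X → ℂ) = 0 := by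
  simp [normI]

omit [TopologicalSpace (Arrow X)] in
theorem normI_add_le (f₁ f₂ : Arrow X → ℂ) : normI (f₁ + f₂) ≤ normI f₁ + normI f₂ := by
  have key : ∀ s : X → Set (Arrow X), ⨆ x, ∑' g : s x, ‖(f₁ + f₂) g‖ₑ ≤
      (⨆ x, ∑' g : s x, ‖f₁ g‖ₑ) + ⨆ x, ∑' g : s x, ‖f₂ g‖ₑ := by
    intro s
    refine iSup_le fun x => ?_
    calc ∑' g : s x, ‖(f₁ + f₂) g‖ₑ ≤ ∑' g : s x, (‖f₁ g‖ₑ + ‖f₂ g‖ₑ) :=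
          ENNReal.tsum_le_tsum fun g => enorm_add_le _ _
      _ = (∑' g : s x, ‖f₁ g‖ₑ) + ∑' g : s x, ‖f₂ g‖ₑ := ENNReal.tsum_add
      _ ≤ _ := add_le_add (le_iSup (fun x => ∑' g : s x, ‖f₁ g‖ₑ) x)
          (le_iSup (fun x => ∑' g : s x, ‖f₂ g‖ₑ) x)
  exact max_le ((key _).trans (add_le_add (le_max_left _ _) (le_max_left _ _)))
    ((key _).trans (add_le_add (le_max_right _ _) (le_max_right _ _)))

/-- A bisection meets each source fibre and each range fibre at most once, so the `I`-norm of a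
function supported on it is its supremum. -/
theorem IsBisectionFunction.normI_le {K : Set (Arrow X)} {f : Arrow X → ℂ}
    (hf : IsBisectionFunction K f) {δ : ℝ} (hδ : ∀ g, ‖f g‖ ≤ δ) :
    normI f ≤ ENNReal.ofReal δ := by
  have key : ∀ s : Set (Arrow X), (∀ g ∈ s, ∀ h ∈ s, g ∈ K → h ∈ K → g = h) →
      ∑' g : s, ‖f g‖ₑ ≤ ENNReal.ofReal δ := by
    intro s hs
    by_cases h : ∃ g ∈ s, g ∈ K
    · obtain ⟨g, hgs, hgK⟩ := h
      rw [tsum_eq_single ⟨g, hgs⟩]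
      · rw [← ofReal_norm]
        exact ENNReal.ofReal_le_ofReal (hδ g)
      · rintro ⟨h, hh⟩ hne
        rw [enorm_eq_zero]
        exact hf.eq_zero h fun hhK => hne (Subtype.ext (hs h hh g hgs hhK hgK))
    · push Not at h
      rw [ENNReal.tsum_eq_zero.2 fun g : s => by simp [hf.eq_zero g.1 (h g.1 g.2)]]
      exact zero_le
  refine max_le (iSup_le fun x => key _ ?_) (iSup_le fun x => key _ ?_)
  · intro g hg h hh hgK hhK
    exact hf.isOpenBisection.injOn_src hgK hhK
      (src_eq_src_iff.2 (Eq.trans (b := x) hg (Eq.symm hh)))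
  · intro g hg h hh hgK hhK
    exact hf.isOpenBisection.injOn_rng hgK hhK
      (rng_eq_rng_iff.2 (Eq.trans (b := x) hg (Eq.symm hh)))

/-! ### Connes' algebra inside the reduced C*-algebra -/

omit [TopologicalSpace (Arrow X)] in
theorem reducedNorm_zero : reducedNorm (0 : Arrow X → ℂ) = 0 := by
  simp [reducedNorm, fibreConv, l2Norm]

theorem mem_reducedCStarAlgebra_of_mem_connesAlgebra {f : Arrow X → ℂ}
    (hf : f ∈ connesAlgebra X) : f ∈ reducedCStarAlgebra X :=
  ⟨fun _ => f, fun _ => hf, fun ε hε => ⟨0, fun m _ n _ => by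
    rwa [sub_self, reducedNorm_zero]⟩, fun _ => tendsto_const_nhds⟩

end Topology

/-! ### Functions on the unit space -/

/-- A function on the unit space, extended by zero to `G`. -/
noncomputable def onUnits (b : unitSpace X → ℂ) : Arrow X → ℂ :=
  Function.extend Subtype.val b 0

theorem onUnits_coe (b : unitSpace X → ℂ) (x : unitSpace X) : onUnits b x.1 = b x :=
  Subtype.val_injective.extend_apply b 0 x

theorem onUnits_of_notMem (b : unitSpace X → ℂ) {g : Arrow X} (hg : g ∉ unitSpace X) :
    onUnits b g = 0 :=
  Function.extend_apply' _ _ _ fun ⟨x, hx⟩ => hg (hx ▸ x.2)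

theorem onUnits_add (a b : unitSpace X → ℂ) : onUnits (a + b) = onUnits a + onUnits b := by
  funext g
  by_cases hg : g ∈ unitSpace X
  · lift g to unitSpace X using hg
    simp [onUnits_coe]
  · simp [onUnits_of_notMem _ hg]

theorem onUnits_smul (c : ℂ) (b : unitSpace X → ℂ) : onUnits (c • b) = c • onUnits b := by
  funext g
  by_cases hg : g ∈ unitSpace X
  · lift g to unitSpace X using hg
    simp [onUnits_coe]
  · simp [onUnits_of_notMem _ hg]

theorem involution_onUnits (b : unitSpace X → ℂ) : involution (onUnits b) = onUnits (star b) := by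
  funext g
  by_cases hg : g ∈ unitSpace X
  · rw [involution, invArrow_of_mem_unitSpace hg]
    lift g to unitSpace X using hg
    simp [onUnits_coe]
  · rw [involution, onUnits_of_notMem _ hg, onUnits_of_notMem _ (mt invArrow_mem_unitSpace_iff.1 hg),
      map_zero]

/-- On functions supported on the unit space, convolution is the pointwise product. -/
theorem conv_onUnits (a b : unitSpace X → ℂ) :
    conv (onUnits a) (onUnits b) = onUnits (a * b) := by
  funext g
  have hterm : ∀ h : sourceFibre g.left,
      onUnits a (mulArrow g (invArrow h.1) h.2.symm) * onUnits b h.1 =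
        onUnits a g * onUnits b h.1 := by
    intro h
    by_cases hh : h.1 ∈ unitSpace X
    · exact congrArg (fun k => onUnits a k * onUnits b h.1)
        (mulArrow_invArrow_of_mem_unitSpace g hh _)
    · rw [onUnits_of_notMem b hh, mul_zero, mul_zero]
  rw [conv, finsum_congr hterm]
  by_cases hg : g ∈ unitSpace X
  · rw [finsum_eq_single _ (⟨g, rfl⟩ : sourceFibre g.left)]
    · lift g to unitSpace X using hg
      simp [onUnits_coe]
    · rintro ⟨h, hh⟩ hne
      rw [onUnits_of_notMem b, mul_zero]
      intro hh'
      have hgh : (⟨h, hh'⟩ : unitSpace X) = ⟨g, hg⟩ :=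
        (src_unit ⟨h, hh'⟩).symm.trans ((src_eq_src_iff.2 hh).trans (src_unit ⟨g, hg⟩))
      exact hne (Subtype.ext (congrArg Subtype.val hgh :))
  · rw [onUnits_of_notMem _ hg, onUnits_of_notMem _ hg]
    simp

variable [TopologicalSpace (Arrow X)]

theorem isBisectionFunction_onUnits (hG : IsEtaleGroupoid X) {V : Set (unitSpace X)}
    (hV : IsOpen V) (hVc : IsCompact V) {b : unitSpace X → ℂ} (hb : Continuous b)
    (hbV : ∀ x ∉ V, b x = 0) : IsBisectionFunction (Subtype.val '' V) (onUnits b) where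
  isCompact := hVc.image continuous_subtype_val
  isOpenBisection := hG.isOpenBisection_image_unit hV
  continuousOn := by
    refine (hb.comp hG.isLocalHomeomorph_src.continuous).continuousOn.congr ?_
    rintro _ ⟨x, -, rfl⟩
    rw [onUnits_coe, Function.comp_apply, src_unit]
  eq_zero g hg := by
    by_cases hg' : g ∈ unitSpace X
    · lift g to unitSpace X using hg'
      rw [onUnits_coe]
      exact hbV g fun h => hg ⟨g, h, rfl⟩
    · exact onUnits_of_notMem b hg'

/-- If `f` is supported on a bisection, then `f^* * f` is supported on the unit space. -/
theorem IsBisectionFunction.conv_involution_self {K : Set (Arrow X)} {f : Arrow X → ℂ}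
    (hf : IsBisectionFunction K f) :
    conv (involution f) f = onUnits fun x => ((‖toUnits K f x‖ ^ 2 : ℝ) : ℂ) := by
  have hK := hf.isOpenBisection
  funext g
  by_cases hg : g ∈ unitSpace X
  · have hterm : ∀ h : sourceFibre g.left,
        involution f (mulArrow g (invArrow h.1) h.2.symm) * f h.1 = ((‖f h.1‖ ^ 2 : ℝ) : ℂ) := by
      intro h
      refine (congrArg (fun k => starRingEnd ℂ (f k) * f h.1)
        ((invArrow_mulArrow_invArrow_eq_iff g h.1 h.2.symm).2 hg)).trans ?_
      rw [Complex.conj_mul', Complex.ofReal_pow]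
    rw [conv, finsum_congr hterm]
    lift g to unitSpace X using hg
    rw [onUnits_coe]
    have hsrc : ∀ h : sourceFibre g.1.left, src h.1 = g := fun h =>
      (src_eq_src_iff.2 h.2).trans (src_unit g)
    by_cases hgK : g ∈ src '' K
    · obtain ⟨h, hh, hhg⟩ := hgK
      have hleft : h.left = g.1.left := src_eq_src_iff.1 (hhg.trans (src_unit g).symm)
      rw [finsum_eq_single _ (⟨h, hleft⟩ : sourceFibre g.1.left)]
      · have hT : toUnits K f g = f h := hhg ▸ toUnits_src hK f hh
        rw [hT]
      · intro k hne
        rw [hf.eq_zero k.1 fun hk => hne (Subtype.ext (hK.injOn_src hk hh ((hsrc k).trans hhg.symm)))]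
        simp
    · rw [toUnits_of_notMem f hgK]
      have : ∀ h : sourceFibre g.1.left, ((‖f h.1‖ ^ 2 : ℝ) : ℂ) = 0 := fun h => by
        rw [hf.eq_zero h.1 fun hh => hgK ⟨h.1, hh, hsrc h⟩]
        simp
      rw [finsum_congr this]
      simp
  · rw [onUnits_of_notMem _ hg, conv]
    refine finsum_eq_zero_of_forall_eq_zero fun h => ?_
    by_cases hh : h.1 ∈ K
    · rw [involution, hf.eq_zero, map_zero, zero_mul]
      intro hk
      refine hg ((invArrow_mulArrow_invArrow_eq_iff g h.1 h.2.symm).1 (hK.injOn_rng hk hh ?_))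
      exact rng_eq_rng_iff.2 rfl
    · rw [hf.eq_zero h.1 hh, mul_zero]

/-! ### C*-norms -/

theorem IsCStarNorm.map_zero {p : (Arrow X → ℂ) → ℝ} (hp : IsCStarNorm p) : p 0 = 0 := by
  simpa using hp.smul 0 0 (Submodule.zero_mem _)

theorem IsCStarNorm.map_sum_le {p : (Arrow X → ℂ) → ℝ} (hp : IsCStarNorm p) {ι : Type*}
    (s : Finset ι) {h : ι → Arrow X → ℂ} (hh : ∀ i, h i ∈ connesAlgebra X) :
    p (∑ i ∈ s, h i) ≤ ∑ i ∈ s, p (h i) := by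
  classical
  induction s using Finset.induction_on with
  | empty => simp [hp.map_zero]
  | insert a s ha ih =>
    rw [Finset.sum_insert ha, Finset.sum_insert ha]
    exact (hp.add_le _ (hh a) _ (Submodule.sum_mem _ fun i _ => hh i)).trans
      (add_le_add_right ih _)

/-- A C*-norm is at most `1` on continuous functions on the unit space with values in `[-1, 1]`
that vanish off a compact open set `V`: such a function `b` is the real part of the function
`u = b + i √(1 - b²)` on `V`, which is unitary with respect to the projection `1_V`. -/
theorem IsCStarNorm.onUnits_le_one (hG : IsEtaleGroupoid X) {p : (Arrow X → ℂ) → ℝ}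
    (hp : IsCStarNorm p) {V : Set (unitSpace X)} (hV : IsClopen V) (hVc : IsCompact V)
    {b : unitSpace X → ℝ} (hb : Continuous b) (hb1 : ∀ x, |b x| ≤ 1) (hbV : ∀ x ∉ V, b x = 0) :
    p (onUnits fun x => (b x : ℂ)) ≤ 1 := by
  have hind : ∀ c : unitSpace X → ℂ, Continuous c → Continuous (V.indicator c) := fun c hc =>
    hc.indicator fun x hx => by simp [hV.frontier_eq] at hx
  have hmem : ∀ c : unitSpace X → ℂ, Continuous c → (∀ x ∉ V, c x = 0) →
      onUnits c ∈ connesAlgebra X := fun c hc hcV =>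
    (isBisectionFunction_onUnits hG hV.isOpen hVc hc hcV).mem_connesAlgebra
  have hcstar : ∀ c : unitSpace X → ℂ, Continuous c → (∀ x ∉ V, c x = 0) →
      p (onUnits (star c * c)) = p (onUnits c) ^ 2 := fun c hc hcV => by
    rw [← hp.involution_conv_self _ (hmem c hc hcV), involution_onUnits, conv_onUnits]
  set e : unitSpace X → ℂ := V.indicator 1 with he
  set u : unitSpace X → ℂ := V.indicator fun x => (b x : ℂ) + Complex.I * (√(1 - b x ^ 2) : ℝ)
    with hu
  have hec : Continuous e := hind _ continuous_one
  have huc : Continuous u := hind _ (by fun_prop)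
  have heV : ∀ x ∉ V, e x = 0 := fun x hx => Set.indicator_of_notMem hx _
  have huV : ∀ x ∉ V, u x = 0 := fun x hx => Set.indicator_of_notMem hx _
  have hee : star e * e = e := by
    funext x
    by_cases hx : x ∈ V <;> simp [he, hx]
  have huu : star u * u = e := by
    funext x
    by_cases hx : x ∈ V
    · have hsq : (√(1 - b x ^ 2)) ^ 2 = 1 - b x ^ 2 :=
        Real.sq_sqrt (by have := (sq_le_one_iff_abs_le_one (b x)).2 (hb1 x); linarith)
      have hsq' : ((√(1 - b x ^ 2) : ℝ) : ℂ) ^ 2 = 1 - (b x : ℂ) ^ 2 := by exact_mod_cast hsq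
      simp only [he, hu, Pi.mul_apply, Pi.star_apply, Set.indicator_of_mem hx, Pi.one_apply,
        Complex.star_def, map_add, map_mul, Complex.conj_ofReal, Complex.conj_I]
      linear_combination hsq' - ((√(1 - b x ^ 2) : ℝ) : ℂ) ^ 2 * Complex.I_sq
    · simp [he, huV x hx, hx]
  -- `e` is a projection, so `p e = (p e)²`
  have hpe : p (onUnits e) ≤ 1 := by
    have h := hcstar e hec heV
    rw [hee] at h
    by_contra! hlt
    nlinarith
  have hpu : p (onUnits u) ≤ 1 := by
    have h := hcstar u huc huV
    rw [huu] at h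
    by_contra! hlt
    nlinarith
  have huV' : ∀ x ∉ V, star u x = 0 := fun x hx => by simp [huV x hx]
  have hpu' : p (onUnits (star u)) ≤ 1 := by
    have h := hcstar (star u) huc.star huV'
    rw [star_star, mul_comm, huu] at h
    by_contra! hlt
    nlinarith
  have hbu : (fun x => (b x : ℂ)) = (1 / 2 : ℂ) • (u + star u) := by
    funext x
    by_cases hx : x ∈ V
    · simp only [hu, Pi.smul_apply, Pi.add_apply, Pi.star_apply, Set.indicator_of_mem hx,
        Complex.star_def, map_add, map_mul, Complex.conj_ofReal, Complex.conj_I, smul_eq_mul]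
      ring
    · simp [huV x hx, hbV x hx]
  have hmu := hmem u huc huV
  have hmu' := hmem (star u) huc.star huV'
  rw [hbu, onUnits_smul, onUnits_add, hp.smul _ _ (Submodule.add_mem _ hmu hmu')]
  have := hp.add_le _ hmu _ hmu'
  norm_num
  linarith

/-- On functions supported on a bisection, every C*-norm is dominated by the supremum norm. -/
theorem IsCStarNorm.le_of_isBisectionFunction (hG : IsEtaleGroupoid X) {p : (Arrow X → ℂ) → ℝ}
    (hp : IsCStarNorm p) {K : Set (Arrow X)} {f : Arrow X → ℂ} (hf : IsBisectionFunction K f)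
    {δ : ℝ} (hδ : 0 < δ) (hfδ : ∀ g, ‖f g‖ ≤ δ) : p f ≤ δ := by
  have hV := hf.isOpenBisection.isClopen_image_src hG hf.isCompact
  have hVc : IsCompact (src '' K) := hf.isCompact.image hG.isLocalHomeomorph_src.continuous
  have hT : ∀ x, ‖toUnits K f x‖ ≤ δ := by
    intro x
    by_cases hx : x ∈ src '' K
    · obtain ⟨g, hg, rfl⟩ := hx
      rw [toUnits_src hf.isOpenBisection f hg]
      exact hfδ g
    · simpa [toUnits_of_notMem f hx] using hδ.le
  set b : unitSpace X → ℝ := fun x => ‖toUnits K f x‖ ^ 2 / δ ^ 2 with hb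
  have hbc : Continuous b := ((hf.continuous_toUnits hG).norm.pow 2).div_const _
  have hbV : ∀ x ∉ src '' K, b x = 0 := fun x hx => by simp [hb, toUnits_of_notMem f hx]
  have hb1 : ∀ x, |b x| ≤ 1 := fun x => by
    rw [abs_of_nonneg (by positivity), hb]
    exact div_le_one_of_le₀ (pow_le_pow_left₀ (norm_nonneg _) (hT x) 2) (by positivity)
  have hle := hp.onUnits_le_one hG hV hVc hbc hb1 hbV
  have heq : conv (involution f) f = ((δ ^ 2 : ℝ) : ℂ) • onUnits fun x => (b x : ℂ) := by
    rw [hf.conv_involution_self, ← onUnits_smul]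
    congr 1
    funext x
    rw [Pi.smul_apply, smul_eq_mul, ← Complex.ofReal_mul, hb]
    congr 1
    field_simp
  have hmem : onUnits (fun x => (b x : ℂ)) ∈ connesAlgebra X :=
    (isBisectionFunction_onUnits hG hV.isOpen hVc (Complex.continuous_ofReal.comp hbc)
      fun x hx => by simp [hbV x hx]).mem_connesAlgebra
  have hsq := hp.involution_conv_self f hf.mem_connesAlgebra
  rw [heq, hp.smul _ _ hmem, Complex.norm_real, Real.norm_of_nonneg (by positivity)] at hsq
  by_contra! hlt
  nlinarith [pow_pos hδ 2]

end EtaleGpd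

open EtaleGpd

theorem theorem4p4 {X : Type u} [CategoryTheory.Groupoid.{v} X]
    [TopologicalSpace (CategoryTheory.Arrow X)] (hG : EtaleGpd.IsAmpleGroupoid X) :
    EtaleGpd.algebraicSingularIdeal X ⊆ EtaleGpd.singularIdeal X ∩ EtaleGpd.connesAlgebra X ∧
    (∀ f ∈ EtaleGpd.singularIdeal X ∩ EtaleGpd.connesAlgebra X, ∀ ε : ℝ≥0∞, 0 < ε →
      ∃ f' ∈ EtaleGpd.algebraicSingularIdeal X, EtaleGpd.normI (f - f') < ε) ∧
    (∀ p : (CategoryTheory.Arrow X → ℂ) → ℝ, EtaleGpd.IsCStarNorm p →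
      ∀ f ∈ EtaleGpd.singularIdeal X ∩ EtaleGpd.connesAlgebra X, ∀ ε : ℝ, 0 < ε →
        ∃ f' ∈ EtaleGpd.algebraicSingularIdeal X, p (f - f') < ε) := by
  refine ⟨fun f hf => ⟨hf.1, steinbergAlgebra_le_connesAlgebra hf.2⟩, ?_, ?_⟩
  · rintro f ⟨⟨-, hsing⟩, hf⟩ ε hε
    obtain ⟨n, happrox⟩ := hG.exists_approx hf hsing
    -- a finite positive real below `ε`, which may be infinite
    obtain ⟨η, -, hη0, hηε⟩ := ENNReal.lt_iff_exists_real_btwn.1 hε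
    rw [ENNReal.ofReal_pos] at hη0
    -- `n + 1` rather than `n`, which may be `0`
    have hδ : 0 < η / (n + 1) := by positivity
    obtain ⟨f', hf', hsing', h, hsum, hh⟩ := happrox _ hδ
    refine ⟨f', ⟨⟨mem_reducedCStarAlgebra_of_mem_connesAlgebra
      (steinbergAlgebra_le_connesAlgebra hf'), hsing'⟩, hf'⟩, lt_of_le_of_lt ?_ hηε⟩
    calc normI (f - f') ≤ ∑ i, normI (h i) := by
          rw [hsum]
          exact Finset.le_sum_of_subadditive _ normI_zero.le normI_add_le _ _
      _ ≤ ∑ _i : Fin n, ENNReal.ofReal (η / (n + 1)) := Finset.sum_le_sum fun i _ => by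
          obtain ⟨⟨K, hK⟩, hle⟩ := hh i
          exact hK.normI_le hle
      _ = ENNReal.ofReal (n * (η / (n + 1))) := by
          rw [Finset.sum_const, Finset.card_fin, nsmul_eq_mul, ENNReal.ofReal_mul (by positivity),
            ENNReal.ofReal_natCast]
      _ ≤ ENNReal.ofReal η := ENNReal.ofReal_le_ofReal (by
          rw [mul_div_assoc', div_le_iff₀ (by positivity)]
          nlinarith)
  · rintro p hp f ⟨⟨-, hsing⟩, hf⟩ ε hε
    obtain ⟨n, happrox⟩ := hG.exists_approx hf hsing
    have hδ : 0 < ε / (n + 1) := by positivity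
    obtain ⟨f', hf', hsing', h, hsum, hh⟩ := happrox _ hδ
    refine ⟨f', ⟨⟨mem_reducedCStarAlgebra_of_mem_connesAlgebra
      (steinbergAlgebra_le_connesAlgebra hf'), hsing'⟩, hf'⟩, ?_⟩
    calc p (f - f') ≤ ∑ i, p (h i) := by
          rw [hsum]
          exact hp.map_sum_le _ fun i => (hh i).1.elim fun K hK => hK.mem_connesAlgebra
      _ ≤ ∑ _i : Fin n, ε / (n + 1) := Finset.sum_le_sum fun i _ => by
          obtain ⟨⟨K, hK⟩, hle⟩ := hh i
          exact hp.le_of_isBisectionFunction hG.toIsEtaleGroupoid hK hδ hle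
      _ = n * (ε / (n + 1)) := by
          rw [Finset.sum_const, Finset.card_fin, nsmul_eq_mul]
      _ < ε := by
          rw [mul_div_assoc', div_lt_iff₀ (by positivity)]
          nlinarith
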